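/- \textbf{Setting.} A relational signature $\Pi$ is a set of relation symbols $R$ with finite arities $\mathrm{ar}(R)\ge 0$. A $\Pi$-edge in a set $X$ is a pair $(R,(x_1,\dots,x_{\mathrm{ar}(R)}))$ with $R\in\Pi$ and $x_i\in X$, also written $Rx_1\dots x_n$; a $\Pi$-structure is a set with a set of $\Pi$-edges in it, and a morphism of $\Pi$-structures is a function that sends edges to edges. Fix an infinite set $\mathsf{Var}$. A relational Horn theory $\mathbb T$ over $\Pi$ is a set of formulas $\Phi\Rightarrow\psi$, where $\Phi$ is a (possibly infinite) set of $\Pi$-edges in $\mathsf{Var}$ and $\psi$ is a $\Pi$-edge in $\mathsf{Var}$ or an equation between two variables. $\mathbb T\text{-}\mathsf{Mod}$ is the full subcategory of $\Pi$-structures that satisfy all formulas of $\mathbb T$ under all valuations of the variables. Assume that $\mathbb T$ is reflexive (in every $\mathbb T$-model $X$ every relation contains all constant tuples $(x,\dots,x)$, $x\in X$) and that $\mathscr V:=\mathbb T\text{-}\mathsf{Mod}$ is cartesian closed, with internal hom $[-,-]$; the elements of $[X,Y]$ correspond to the morphisms $X\to Y$. Let $\mathcal S$ be a set of sorts, $\mathscr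 V^{\mathcal S}$ the $\mathscr V$-category of $\mathcal S$-indexed families of $\mathbb T$-models, with hom-objects $\prod_S [X_S,Y_S]$, and $\mathbb N_{\mathcal S}$ the set of finitely supported functions $J:\mathcal S\to\mathbb N$; write $X^J:=\prod_{S} X_S^{J(S)}$. \textbf{Theories.} A $\mathscr V$-enriched $\mathcal S$-sorted signature $\Sigma$ is a set of operation symbols, each with a type $(J,S,P)$, where $J\in\mathbb N_{\mathcal S}$, $S\in\mathcal S$ and the parameter object $P$ is a $\mathbb T$-model; $\Sigma$ is classical if every $P$ is the terminal object $1$. A $\Sigma$-algebra is an object $A$ of $\mathscr V^{\mathcal S}$ with a morphism $\sigma^A:P\times A^J\to A_S$ for each $\sigma\in\Sigma$ of type $(J,S,P)$. The $\mathscr V$-category $\Sigma\text{-}\mathsf{Alg}$ over $\mathscr V^{\mathcal S}$ has as hom-object from $A$ to $B$ the pairwise equalizer, over all $\sigma\in\Sigma$, of the two canonical morphisms $\mathscr V^{\mathcal S}(A,B)\rightrightarrows[P\times A^J,B_S]$ induced by $\sigma^B$ and by $\sigma^A$; its identities and composition are inherited from $\mathscr V^{\mathcal S}$. The underlying classical signature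 $|\Sigma|$ has an operation symbol $\sigma_p$ of type $(J,S,1)$ for each $\sigma\in\Sigma$ of type $(J,S,P)$ and each element $p$ of $P$; every $\Sigma$-algebra $A$ has an underlying $|\Sigma|$-algebra, in which $\sigma_p$ is interpreted as $\sigma^A(p,-)$. For a classical signature $\Sigma$ and $J\in\mathbb N_{\mathcal S}$, let $\vec v:J$ be the variable context that consists of $J(S)$ distinct variables of each sort $S$; a term $t$ of sort $S$ in context $\vec v:J$ is interpreted in a $\Sigma$-algebra $A$ as a morphism $t^A:A^J\to A_S$. A syntactic $\Sigma$-equation $s\doteq t$ is a pair of terms of the same sort in the same context $\vec v:J$; $A$ satisfies it if $s^A=t^A$. A $(\Sigma,\Pi)$-relation of sort $S$ in context $\vec v:J$ is a $\Pi$-edge $Rt_1\dots t_n$ in the set of terms of sort $S$ in context $\vec v:J$; $A$ satisfies it if $Rt_1^A\dots t_n^A$ holds in the $\mathbb T$-model $[A^J,A_S]$. A $\mathscr V$-enriched $\mathcal S$-sorted equational theory is a pair $\mathcal T=(\Sigma,\mathcal E)$ of a $\mathscr V$-enriched $\mathcal S$-sorted signature $\Sigma$ and a set $\mathcal E$ of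 syntactic $|\Sigma|$-equations; $\mathcal T\text{-}\mathsf{Alg}$ is the full sub-$\mathscr V$-category of $\Sigma\text{-}\mathsf{Alg}$ on the algebras whose underlying $|\Sigma|$-algebra satisfies $\mathcal E$. A classical $\mathcal S$-sorted equational theory with $\mathbb T$-relations is a triple $\mathcal P=(\Sigma,\mathcal R,\mathcal E)$ of a classical signature $\Sigma$, a set $\mathcal R$ of $(\Sigma,\Pi)$-relations and a set $\mathcal E$ of syntactic $\Sigma$-equations; $\mathcal P\text{-}\mathsf{Alg}$ is the full sub-$\mathscr V$-category of $\Sigma\text{-}\mathsf{Alg}$ on the algebras that satisfy $\mathcal R$ and $\mathcal E$. \textbf{Proposition.} For every classical $\mathcal S$-sorted equational theory with $\mathbb T$-relations $\mathcal P=(\Sigma,\mathcal R,\mathcal E)$ there is a $\mathscr V$-enriched $\mathcal S$-sorted equational theory $\mathcal T_{\mathcal P}$ such that $\mathcal P\text{-}\mathsf{Alg}\cong\mathcal T_{\mathcal P}\text{-}\mathsf{Alg}$ as $\mathscr V$-categories over $\mathscr V^{\mathcal S}$; that is, there are mutually inverse $\mathscr V$-functors between them that commute strictly with the forgetful $\mathscr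 V$-functors to $\mathscr V^{\mathcal S}$. Moreover, $\mathcal T_{\mathcal P}=(\Sigma^+,\mathcal E^+)$ can be taken of the following form. For $J\in\mathbb N_{\mathcal S}$ and $S\in\mathcal S$ let $P_{J,S}$ be the $\Pi$-structure whose elements are the terms $t_i$ that occur in the relations $Rt_1\dots t_n$ of $\mathcal R$ of sort $S$ in context $\vec v:J$, and whose edges are these relations, and let $\eta_{J,S}:P_{J,S}\to P_{J,S}^\sharp$ be a free $\mathbb T$-model on it. Then $\Sigma^+$ is $\Sigma$ with one operation symbol $\sigma_{J,S}$ of type $(J,S,P_{J,S}^\sharp)$ adjoined for each pair $(J,S)$, and $\mathcal E^+$ is $\mathcal E$ together with the equations $(\sigma_{J,S})_{\eta_{J,S}(t)}(\vec v)\doteq t$ in context $\vec v:J$ for all $(J,S)$ and all elements $t$ of $P_{J,S}$. -/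

import Mathlib

open CategoryTheory MonoidalCategory CartesianMonoidalCategory

universe u

/-! ## Relational structures and relational Horn theories -/

/-- A finitary relational signature: a set of relation symbols with finite arities. -/
structure RelSignature where
  /-- the relation symbols -/
  Symb : Type u
  /-- the arity of a relation symbol -/
  arity : Symb → ℕ

/-- An edge in `X`: a relation symbol together with a tuple of elements of `X` of its arity. -/
def RelSignature.Edge (L : RelSignature.{u}) (X : Type u) : Type u :=
  Σ R : L.Symb, (Fin (L.arity R) → X)

/-- The image `h · e` of an edge under a function. -/
def RelSignature.Edge.map {L : RelSignature.{u}} {X Y : Type u} (h : X → Y) (e : L.Edge X) :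
    L.Edge Y :=
  ⟨e.1, fun i => h (e.2 i)⟩

/-- A structure for a relational signature: a set equipped with a set of edges. -/
structure RelStr (L : RelSignature.{u}) where
  /-- the underlying set -/
  carrier : Type u
  /-- the edges of the structure -/
  edges : Set (L.Edge carrier)

instance (L : RelSignature.{u}) : CoeSort (RelStr L) (Type u) := ⟨RelStr.carrier⟩

/-- A morphism of structures: a function that sends edges to edges. -/
@[ext]
structure RelStr.Hom {L : RelSignature.{u}} (X Y : RelStr L) where
  /-- the underlying function -/
  toFun : X → Y
  map_edges : ∀ e ∈ X.edges, e.map toFun ∈ Y.edges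

instance {L : RelSignature.{u}} (X Y : RelStr L) : CoeFun (RelStr.Hom X Y) (fun _ => X → Y) :=
  ⟨RelStr.Hom.toFun⟩

/-- Composition of morphisms of structures (in diagrammatic order). -/
def RelStr.Hom.comp {L : RelSignature.{u}} {X Y Z : RelStr L} (f : RelStr.Hom X Y)
    (g : RelStr.Hom Y Z) : RelStr.Hom X Z where
  toFun x := g (f x)
  map_edges e he := g.map_edges _ (f.map_edges e he)

/-- A relational Horn formula `Φ ⟹ ψ`: the premises form a set of edges in the set of variables,
and the conclusion is either an edge in the set of variables or an equation `v ≐ w`. -/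
structure HornFormula (L : RelSignature.{u}) (Var : Type u) where
  /-- the set `Φ` of premises -/
  premises : Set (L.Edge Var)
  /-- the conclusion `ψ` -/
  conclusion : L.Edge Var ⊕ (Var × Var)

/-- `X` satisfies `Φ ⟹ ψ` if every valuation that makes all members of `Φ` true makes `ψ` true. -/
def RelStr.Satisfies {L : RelSignature.{u}} {Var : Type u} (X : RelStr L)
    (φ : HornFormula L Var) : Prop :=
  ∀ κ : Var → X, (∀ e ∈ φ.premises, e.map κ ∈ X.edges) →
    match φ.conclusion with
    | Sum.inl e => e.map κ ∈ X.edges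
    | Sum.inr vw => κ vw.1 = κ vw.2

/-- A relational Horn theory is a set of relational Horn formulas. -/
def HornTheory (L : RelSignature.{u}) (Var : Type u) : Type u := Set (HornFormula L Var)

namespace HornTheory

variable {L : RelSignature.{u}} {Var : Type u}

/-- Models of a relational Horn theory. -/
structure Mod (T : HornTheory L Var) extends RelStr L where
  sat : ∀ φ : HornFormula L Var, φ ∈ (show Set (HornFormula L Var) from T) → toRelStr.Satisfies φ

variable {T : HornTheory L Var}

instance : CoeSort T.Mod (Type u) := ⟨fun X => X.carrier⟩

/-- The category of models: the morphisms are all morphisms of the underlying structures. -/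
instance : Category.{u} T.Mod where
  Hom X Y := RelStr.Hom X.toRelStr Y.toRelStr
  id X := ⟨fun x => x, fun _ he => he⟩
  comp f g := f.comp g

instance (X Y : T.Mod) : CoeFun (X ⟶ Y) (fun _ => X → Y) := ⟨RelStr.Hom.toFun⟩

theorem Mod.hom_ext' {X Y : T.Mod} {f g : X ⟶ Y} (h : ∀ x, f x = g x) : f = g :=
  RelStr.Hom.ext (funext h)

@[simp] theorem Mod.comp_apply {X Y Z : T.Mod} (f : X ⟶ Y) (g : Y ⟶ Z) (x : X) :
    (f ≫ g) x = g (f x) := rfl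

@[simp] theorem Mod.id_apply {X : T.Mod} (x : X) : (𝟙 X : X ⟶ X) x = x := rfl

/-- The theory is reflexive: in every model, every relation contains all constant tuples. -/
class IsReflexive (T : HornTheory L Var) : Prop where
  refl : ∀ (X : T.Mod) (R : L.Symb) (x : X), (⟨R, fun _ => x⟩ : L.Edge X) ∈ X.edges

/-! ## Products and submodels -/

/-- The terminal model: one point, at which all relations hold. -/
def one (T : HornTheory L Var) : T.Mod where
  carrier := PUnit
  edges := Set.univ
  sat φ _ κ _ := by
    rcases φ.conclusion with e | vw
    · exact Set.mem_univ _
    · rfl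

/-- The product of two models. -/
def prod (X Y : T.Mod) : T.Mod where
  carrier := X × Y
  edges := {e | e.map Prod.fst ∈ X.edges ∧ e.map Prod.snd ∈ Y.edges}
  sat φ hφ κ hκ := by
    have h1 := X.sat φ hφ (fun v => (κ v).1) (fun e he => (hκ e he).1)
    have h2 := Y.sat φ hφ (fun v => (κ v).2) (fun e he => (hκ e he).2)
    rcases h : φ.conclusion with e | vw
    · simp only [h] at h1 h2
      exact ⟨h1, h2⟩
    · simp only [h] at h1 h2
      exact Prod.ext h1 h2

/-- The product of a family of models. -/
def pi {ι : Type u} (X : ι → T.Mod) : T.Mod where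
  carrier := ∀ i, X i
  edges := {e | ∀ i, e.map (fun x => x i) ∈ (X i).edges}
  sat φ hφ κ hκ := by
    have h1 := fun i => (X i).sat φ hφ (fun v => κ v i) (fun e he => hκ e he i)
    rcases h : φ.conclusion with e | vw
    · simp only [h] at h1
      exact h1
    · simp only [h] at h1
      exact funext h1

/-- The projections of a product of a family of models. -/
def piProj {ι : Type u} (X : ι → T.Mod) (i : ι) : pi X ⟶ X i where
  toFun x := x i
  map_edges _ he := he i

/-- The morphism into a product of a family of models with given components. -/
def piLift {ι : Type u} {X : ι → T.Mod} {Y : T.Mod} (f : ∀ i, Y ⟶ X i) : Y ⟶ pi X where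
  toFun y i := f i y
  map_edges e he i := (f i).map_edges e he

/-- A subset of a model, with the induced relations. -/
def sub (X : T.Mod) (p : X → Prop) : T.Mod where
  carrier := {x : X // p x}
  edges := {e | e.map Subtype.val ∈ X.edges}
  sat φ hφ κ hκ := by
    have h1 := X.sat φ hφ (fun v => (κ v).1) hκ
    rcases h : φ.conclusion with e | vw
    · simp only [h] at h1
      exact h1
    · simp only [h] at h1
      exact Subtype.ext h1

/-- The inclusion of a submodel. -/
def subIncl (X : T.Mod) (p : X → Prop) : sub X p ⟶ X where
  toFun := Subtype.val
  map_edges _ he := he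

/-- The corestriction of a morphism to a submodel. -/
def subLift {X Y : T.Mod} {p : X → Prop} (f : Y ⟶ X) (h : ∀ y, p (f y)) : Y ⟶ sub X p where
  toFun y := ⟨f y, h y⟩
  map_edges e he := f.map_edges e he

/-- The finite product structure on the category of models, given by the products above. -/
instance : MonoidalCategory T.Mod where
  tensorObj X Y := prod X Y
  tensorUnit := one T
  tensorHom f g := ⟨fun x => (f x.1, g x.2), fun _ he =>
    ⟨f.map_edges _ he.1, g.map_edges _ he.2⟩⟩
  whiskerLeft _ _ _ g := ⟨fun x => (x.1, g x.2), fun _ he => ⟨he.1, g.map_edges _ he.2⟩⟩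
  whiskerRight f _ := ⟨fun x => (f x.1, x.2), fun _ he => ⟨f.map_edges _ he.1, he.2⟩⟩
  associator _ _ _ :=
    { hom := ⟨fun x => (x.1.1, (x.1.2, x.2)), fun _ he => ⟨he.1.1, he.1.2, he.2⟩⟩
      inv := ⟨fun x => ((x.1, x.2.1), x.2.2), fun _ he => ⟨⟨he.1, he.2.1⟩, he.2.2⟩⟩
      hom_inv_id := rfl
      inv_hom_id := rfl }
  leftUnitor _ :=
    { hom := ⟨fun x => x.2, fun _ he => he.2⟩
      inv := ⟨fun x => (PUnit.unit, x), fun _ he => ⟨Set.mem_univ _, he⟩⟩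
      hom_inv_id := rfl
      inv_hom_id := rfl }
  rightUnitor _ :=
    { hom := ⟨fun x => x.1, fun _ he => he.1⟩
      inv := ⟨fun x => (x, PUnit.unit), fun _ he => ⟨he, Set.mem_univ _⟩⟩
      hom_inv_id := rfl
      inv_hom_id := rfl }
  tensorHom_def _ _ := rfl
  id_tensorHom_id _ _ := rfl
  tensorHom_comp_tensorHom _ _ _ _ := rfl
  whiskerLeft_id _ _ := rfl
  id_whiskerRight _ _ := rfl
  associator_naturality _ _ _ := rfl
  leftUnitor_naturality _ := rfl
  rightUnitor_naturality _ := rfl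
  pentagon _ _ _ _ := rfl
  triangle _ _ := rfl

instance : CartesianMonoidalCategory T.Mod where
  isTerminalTensorUnit := Limits.IsTerminal.ofUniqueHom
    (fun X => (⟨fun _ => PUnit.unit, fun _ _ => Set.mem_univ _⟩ : X ⟶ one T)) (fun _ _ => rfl)
  fst X Y := (⟨Prod.fst, fun _ he => he.1⟩ : prod X Y ⟶ X)
  snd X Y := (⟨Prod.snd, fun _ he => he.2⟩ : prod X Y ⟶ Y)
  fst_def _ _ := rfl
  snd_def _ _ := rfl
  tensorProductIsBinaryProduct X Y := Limits.BinaryFan.IsLimit.mk _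
    (fun {W} f g => (⟨fun w => (f w, g w), fun e he => ⟨f.map_edges e he, g.map_edges e he⟩⟩ :
      W ⟶ prod X Y))
    (fun _ _ => rfl) (fun _ _ => rfl)
    (fun f g m h1 h2 => by
      subst h1
      subst h2
      rfl)

/-- The global element of a model at a given point; it exists since the theory is reflexive. -/
def point [T.IsReflexive] (X : T.Mod) (x : X) : 𝟙_ T.Mod ⟶ X where
  toFun _ := x
  map_edges e _ := IsReflexive.refl X e.1 x

/-! ## Internal homs, and the category of families of models as an enriched category -/

section Closed

open scoped MonoidalClosed

variable [MonoidalClosed T.Mod]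

/-- Evaluation of an element of the internal hom `[X, Y]` at an element of `X`. -/
def evalAt {X Y : T.Mod} (h : (ihom X).obj Y) (x : X) : Y :=
  ((ihom.ev X).app Y) ((x, h) : (X × (ihom X).obj Y : Type u))

/-- The element of the internal hom `[X, Y]` that corresponds to a morphism `X ⟶ Y`. -/
def homElem {X Y : T.Mod} (f : X ⟶ Y) : (ihom X).obj Y :=
  (MonoidalClosed.curry' f) PUnit.unit

theorem evalAt_curry {X Y Z : T.Mod} (f : X ⊗ Y ⟶ Z) (x : X) (y : Y) :
    evalAt ((MonoidalClosed.curry f) y) x = f ((x, y) : (X × Y : Type u)) :=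
  congrFun (congrArg RelStr.Hom.toFun (MonoidalClosed.whiskerLeft_curry_ihom_ev_app (g := f)))
    ((x, y) : (X × Y : Type u))

theorem evalAt_homElem {X Y : T.Mod} (f : X ⟶ Y) (x : X) : evalAt (homElem f) x = f x :=
  evalAt_curry _ _ _

theorem evalAt_map {X Y Z : T.Mod} (g : Y ⟶ Z) (h : (ihom X).obj Y) (x : X) :
    evalAt (((ihom X).map g) h) x = g (evalAt h x) :=
  congrFun (congrArg RelStr.Hom.toFun (ihom.ev_naturality (A := X) g))
    ((x, h) : (X × (ihom X).obj Y : Type u))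

theorem evalAt_pre {X Y Z : T.Mod} (g : X ⟶ Y) (h : (ihom Y).obj Z) (x : X) :
    evalAt (((MonoidalClosed.pre g).app Z) h) x = evalAt h (g x) :=
  congrFun (congrArg RelStr.Hom.toFun (MonoidalClosed.id_tensor_pre_app_comp_ev g Z))
    ((x, h) : (X × (ihom Y).obj Z : Type u))

theorem evalAt_id {X : T.Mod} (x : X) (z : (𝟙_ T.Mod : T.Mod)) :
    evalAt ((MonoidalClosed.id X) z) x = x :=
  evalAt_curry _ _ _

theorem evalAt_comp {X Y Z : T.Mod} (h : (ihom X).obj Y) (k : (ihom Y).obj Z) (x : X) :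
    evalAt ((MonoidalClosed.comp X Y Z) ((h, k) : ((ihom X).obj Y × (ihom Y).obj Z : Type u))) x =
      evalAt k (evalAt h x) :=
  evalAt_curry (MonoidalClosed.compTranspose X Y Z) x _

/-- Elements of an internal hom are determined by evaluation. -/
theorem evalAt_ext [T.IsReflexive] {X Y : T.Mod} {h k : (ihom X).obj Y}
    (H : ∀ x, evalAt h x = evalAt k x) : h = k := by
  have : point _ h = point _ k := by
    apply MonoidalClosed.uncurry_injective
    apply Mod.hom_ext'
    intro x
    exact H x.1
  exact congrFun (congrArg RelStr.Hom.toFun this) PUnit.unit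

/-- Objects of the product category `T-Mod^S`: families of models indexed by the sorts. -/
def Fam (T : HornTheory L Var) (S : Type u) : Type (u + 1) := S → T.Mod

variable {S : Type u}

/-- `T-Mod^S` as a `T-Mod`-category: the hom-objects are the products of the `[X_s, Y_s]`, with
the componentwise identities and composition of the `T-Mod`-category `T-Mod`. -/
instance Fam.enriched : EnrichedCategory T.Mod (Fam T S) where
  Hom X Y := pi fun s => (ihom (X s)).obj (Y s)
  id X := piLift fun s => MonoidalClosed.id (X s)
  comp X Y Z := piLift fun s =>
    (piProj (fun s => (ihom (X s)).obj (Y s)) s ⊗ₘ piProj (fun s => (ihom (Y s)).obj (Z s)) s) ≫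
      MonoidalClosed.comp (X s) (Y s) (Z s)
  id_comp X Y := Mod.hom_ext' fun f => funext fun s =>
    congrFun (congrArg RelStr.Hom.toFun (MonoidalClosed.id_comp (X s) (Y s))) (f s)
  comp_id X Y := Mod.hom_ext' fun f => funext fun s =>
    congrFun (congrArg RelStr.Hom.toFun (MonoidalClosed.comp_id (X s) (Y s))) (f s)
  assoc W X Y Z := Mod.hom_ext' fun f => funext fun s =>
    congrFun (congrArg RelStr.Hom.toFun (MonoidalClosed.assoc (W s) (X s) (Y s) (Z s)))
      ((f.1 s, (f.2.1 s, f.2.2 s)) : ((ihom (W s)).obj (X s) × ((ihom (X s)).obj (Y s) ×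
        (ihom (Y s)).obj (Z s)) : Type u))

end Closed

end HornTheory

/-! ## Enriched and classical many-sorted signatures -/

open HornTheory

/-- A signature with sorts in `S`, enriched in the category of models of `T`: every operation
symbol has input sorts `J` (a finitely supported function from sorts to natural numbers), an
output sort, and a parameter object. -/
structure EnrichedSignature {L : RelSignature.{u}} {Var : Type u} (T : HornTheory L Var)
    (S : Type u) where
  /-- the operation symbols -/
  Op : Type u
  /-- the input sorts -/
  inputs : Op → (S →₀ ℕ)
  /-- the output sort -/
  output : Op → S
  /-- the parameter object -/
  param : Op → T.Mod

/-- A classical signature with sorts in `S`. -/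
structure ClassicalSignature (S : Type u) where
  /-- the operation symbols -/
  Op : Type u
  /-- the input sorts -/
  inputs : Op → (S →₀ ℕ)
  /-- the output sort -/
  output : Op → S

/-- A classical signature is an enriched one all of whose parameter objects are terminal. -/
def ClassicalSignature.toEnriched {S : Type u} (Sg : ClassicalSignature S)
    {L : RelSignature.{u}} {Var : Type u} (T : HornTheory L Var) : EnrichedSignature T S where
  Op := Sg.Op
  inputs := Sg.inputs
  output := Sg.output
  param _ := 𝟙_ T.Mod

/-- The variables of the context `v : J`, which has `J s` distinct variables of each sort `s`. -/
abbrev CtxVar {S : Type u} (J : S →₀ ℕ) : Type u := Σ s : S, Fin (J s)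

/-- Terms in the context `v : J`, indexed by their sort. -/
inductive ClassicalSignature.Term {S : Type u} (Sg : ClassicalSignature S) (J : S →₀ ℕ) :
    S → Type u
  | var (v : CtxVar J) : Term Sg J v.1
  | app (o : Sg.Op) (args : ∀ v : CtxVar (Sg.inputs o), Term Sg J v.1) : Term Sg J (Sg.output o)

/-- A syntactic equation of sort `s` in context `v : J` is an ordered pair of terms. -/
abbrev ClassicalSignature.Eqn {S : Type u} (Sg : ClassicalSignature S) (J : S →₀ ℕ) (s : S) :
    Type u :=
  Sg.Term J s × Sg.Term J s

namespace HornTheory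

variable {L : RelSignature.{u}} {Var : Type u} {T : HornTheory L Var} {S : Type u}

/-- The object `X^J`, the product of `J s` copies of `X s` for all sorts `s`. -/
def Fam.pow (X : Fam T S) (J : S →₀ ℕ) : T.Mod := pi fun v : CtxVar J => X v.1

end HornTheory

namespace EnrichedSignature

variable {L : RelSignature.{u}} {Var : Type u} {T : HornTheory L Var} {S : Type u}

/-- Algebras for an enriched signature: a carrier `A` together with, for each operation symbol of
type `(J, s, P)`, a morphism `P × A^J ⟶ A_s`. -/
structure Algebra (Sg : EnrichedSignature T S) where
  /-- the carrier object -/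
  carrier : Fam T S
  /-- the interpretation of the operation symbols -/
  op : ∀ o : Sg.Op, Sg.param o ⊗ carrier.pow (Sg.inputs o) ⟶ carrier (Sg.output o)

/-- The underlying classical signature: one ordinary operation symbol for each operation symbol
and each element of its parameter object. -/
def underlying (Sg : EnrichedSignature T S) : ClassicalSignature S where
  Op := Σ o : Sg.Op, Sg.param o
  inputs o := Sg.inputs o.1
  output o := Sg.output o.1

/-- The underlying algebra of an algebra, with operations `σ(p, -) : A^J ⟶ A_s`. -/
def Algebra.underlying [T.IsReflexive] {Sg : EnrichedSignature T S} (A : Sg.Algebra) :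
    (Sg.underlying.toEnriched T).Algebra where
  carrier := A.carrier
  op o := point (Sg.param o.1) o.2 ▷ A.carrier.pow (Sg.inputs o.1) ≫ A.op o.1

/-! ### The enriched category of algebras -/

variable [MonoidalClosed T.Mod] {Sg : EnrichedSignature T S}

/-- The morphism `T-Mod^S(A, B) ⟶ [P × A^J, P × B^J]` given by the enriched functor `P × (-)^J`:
it is the transpose of `(P × A^J) × T-Mod^S(A, B) ⟶ P × B^J`, `((p, a), f) ↦ (p, f^J a)`. -/
def paramPowMap (P : T.Mod) (J : S →₀ ℕ) (A B : Fam T S) :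
    (A ⟶[T.Mod] B) ⟶ (ihom (P ⊗ A.pow J)).obj (P ⊗ B.pow J) :=
  MonoidalClosed.curry (lift (fst _ _ ≫ fst _ _) (piLift fun v : CtxVar J =>
    lift (fst _ _ ≫ snd _ _ ≫ piProj (fun v : CtxVar J => A v.1) v)
      (snd _ _ ≫ piProj (fun s => (ihom (A s)).obj (B s)) v.1) ≫
    (ihom.ev (A v.1)).app (B v.1)))

/-- The first morphism of the parallel pair at the operation symbol `o`, which is
`T-Mod^S(A, B) ⟶ [P × A^J, P × B^J] ⟶ [P × A^J, B_s]`. -/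
def Algebra.pairFst (A B : Sg.Algebra) (o : Sg.Op) :
    (A.carrier ⟶[T.Mod] B.carrier) ⟶
      (ihom (Sg.param o ⊗ A.carrier.pow (Sg.inputs o))).obj (B.carrier (Sg.output o)) :=
  paramPowMap (Sg.param o) (Sg.inputs o) A.carrier B.carrier ≫ (ihom _).map (B.op o)

/-- The second morphism of the parallel pair at the operation symbol `o`, which is
`T-Mod^S(A, B) ⟶ [A_s, B_s] ⟶ [P × A^J, B_s]`. -/
def Algebra.pairSnd (A B : Sg.Algebra) (o : Sg.Op) :
    (A.carrier ⟶[T.Mod] B.carrier) ⟶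
      (ihom (Sg.param o ⊗ A.carrier.pow (Sg.inputs o))).obj (B.carrier (Sg.output o)) :=
  piProj (fun s => (ihom (A.carrier s)).obj (B.carrier s)) (Sg.output o) ≫
    (MonoidalClosed.pre (A.op o)).app (B.carrier (Sg.output o))

/-- The elements of `T-Mod^S(A, B)` on which all the parallel pairs agree. -/
def Algebra.IsHom (A B : Sg.Algebra) (f : (A.carrier ⟶[T.Mod] B.carrier : T.Mod)) : Prop :=
  ∀ o : Sg.Op, (A.pairFst B o) f = (A.pairSnd B o) f

/-- The element `f^J a` of `B^J`. -/
def powApply {A B : Fam T S} {J : S →₀ ℕ} (f : (A ⟶[T.Mod] B : T.Mod)) (a : A.pow J) : B.pow J :=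
  fun v => evalAt (f v.1) (a v)

/-- The equalized elements are precisely the morphisms of algebras. -/
theorem Algebra.isHom_iff [T.IsReflexive] (A B : Sg.Algebra)
    (f : (A.carrier ⟶[T.Mod] B.carrier : T.Mod)) :
    A.IsHom B f ↔ ∀ (o : Sg.Op) (p : Sg.param o) (a : A.carrier.pow (Sg.inputs o)),
      (B.op o) ((p, powApply f a) : (Sg.param o × B.carrier.pow (Sg.inputs o) : Type u)) =
        evalAt (f (Sg.output o))
          ((A.op o) ((p, a) : (Sg.param o × A.carrier.pow (Sg.inputs o) : Type u))) := by
  have h1 : ∀ (o : Sg.Op) (p : Sg.param o) (a : A.carrier.pow (Sg.inputs o)),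
      evalAt ((A.pairFst B o) f) (show (Sg.param o ⊗ A.carrier.pow (Sg.inputs o) : T.Mod) from
        (p, a)) =
      (B.op o) ((p, powApply f a) : (Sg.param o × B.carrier.pow (Sg.inputs o) : Type u)) := by
    intro o p a
    refine (evalAt_map _ _ _).trans ?_
    exact congrArg (B.op o) (evalAt_curry _ _ _)
  have h2 : ∀ (o : Sg.Op) (p : Sg.param o) (a : A.carrier.pow (Sg.inputs o)),
      evalAt ((A.pairSnd B o) f) (show (Sg.param o ⊗ A.carrier.pow (Sg.inputs o) : T.Mod) from
        (p, a)) =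
      evalAt (f (Sg.output o))
        ((A.op o) ((p, a) : (Sg.param o × A.carrier.pow (Sg.inputs o) : Type u))) :=
    fun o p a => evalAt_pre _ _ _
  constructor
  · intro h o p a
    rw [← h1, ← h2, h o]
  · intro h o
    apply evalAt_ext
    rintro ⟨p, a⟩
    exact (h1 o p a).trans ((h o p a).trans (h2 o p a).symm)

theorem Algebra.isHom_id [T.IsReflexive] (A : Sg.Algebra) (z : (𝟙_ T.Mod : T.Mod)) :
    A.IsHom A ((eId T.Mod A.carrier) z) := by
  have key : ∀ s (x : A.carrier s), evalAt ((eId T.Mod A.carrier) z s) x = x :=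
    fun s x => evalAt_id x z
  rw [isHom_iff]
  intro o p a
  rw [key]
  have : powApply ((eId T.Mod A.carrier) z) a = a := funext fun v => key _ _
  rw [this]

theorem Algebra.isHom_comp [T.IsReflexive] {A B C : Sg.Algebra}
    {f : (A.carrier ⟶[T.Mod] B.carrier : T.Mod)} {g : (B.carrier ⟶[T.Mod] C.carrier : T.Mod)}
    (hf : A.IsHom B f) (hg : B.IsHom C g) :
    A.IsHom C ((eComp T.Mod A.carrier B.carrier C.carrier) ((f, g) :
      ((A.carrier ⟶[T.Mod] B.carrier : T.Mod) × (B.carrier ⟶[T.Mod] C.carrier : T.Mod) :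
        Type u))) := by
  have key : ∀ s (x : A.carrier s), evalAt ((eComp T.Mod A.carrier B.carrier C.carrier) ((f, g) :
      ((A.carrier ⟶[T.Mod] B.carrier : T.Mod) × (B.carrier ⟶[T.Mod] C.carrier : T.Mod) :
        Type u)) s) x = evalAt (g s) (evalAt (f s) x) :=
    fun s x => evalAt_comp (f s) (g s) x
  rw [isHom_iff] at hf hg ⊢
  intro o p a
  rw [key, ← hf, ← hg]
  congr 2
  exact funext fun v => key _ _

/-- The enriched category of algebras: the hom-object is the pairwise equalizer of the parallel
pairs above, that is, the submodel of `T-Mod^S(A, B)` on which they all agree, and identities and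
composition are inherited from `T-Mod^S`. -/
instance Algebra.enriched [T.IsReflexive] : EnrichedCategory T.Mod Sg.Algebra where
  Hom A B := sub (A.carrier ⟶[T.Mod] B.carrier) (A.IsHom B)
  id A := subLift (eId T.Mod A.carrier) A.isHom_id
  comp A B C := subLift ((subIncl _ (A.IsHom B) ⊗ₘ subIncl _ (B.IsHom C)) ≫
    eComp T.Mod A.carrier B.carrier C.carrier) (fun x => isHom_comp x.1.2 x.2.2)
  id_comp A B := Mod.hom_ext' fun f => Subtype.ext <|
    congrFun (congrArg RelStr.Hom.toFun (e_id_comp T.Mod A.carrier B.carrier)) f.1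
  comp_id A B := Mod.hom_ext' fun f => Subtype.ext <|
    congrFun (congrArg RelStr.Hom.toFun (e_comp_id T.Mod A.carrier B.carrier)) f.1
  assoc A B C D := Mod.hom_ext' fun f => Subtype.ext <|
    congrFun (congrArg RelStr.Hom.toFun (e_assoc T.Mod A.carrier B.carrier C.carrier D.carrier))
      ((f.1.1, (f.2.1.1, f.2.2.1)) : ((A.carrier ⟶[T.Mod] B.carrier : T.Mod) ×
        ((B.carrier ⟶[T.Mod] C.carrier : T.Mod) × (C.carrier ⟶[T.Mod] D.carrier : T.Mod)) :
          Type u))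

/-- The forgetful enriched functor from algebras to `T-Mod^S`. -/
def forget (Sg : EnrichedSignature T S) [T.IsReflexive] :
    EnrichedFunctor T.Mod Sg.Algebra (Fam T S) where
  obj A := A.carrier
  map A B := subIncl _ (A.IsHom B)
  map_id _ := rfl
  map_comp _ _ _ := rfl

end EnrichedSignature

/-! ## Interpretation of terms, theories and their algebras -/

section Theories

variable {L : RelSignature.{u}} {Var : Type u} {T : HornTheory L Var} {S : Type u}

/-- The interpretation `A^J ⟶ A_s` of a term of sort `s` in context `v : J`. -/
def ClassicalSignature.Term.interp {Sg : ClassicalSignature S} (A : (Sg.toEnriched T).Algebra)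
    {J : S →₀ ℕ} : ∀ {s : S}, Sg.Term J s → (A.carrier.pow J ⟶ A.carrier s)
  | _, .var v => piProj (fun v : CtxVar J => A.carrier v.1) v
  | _, .app o args =>
      piLift (fun v : CtxVar (Sg.inputs o) => (args v).interp A) ≫
        (λ_ (A.carrier.pow (Sg.inputs o))).inv ≫ A.op o

/-- Satisfaction of a syntactic equation. -/
def EnrichedSignature.Algebra.SatEqn {Sg : ClassicalSignature S} (A : (Sg.toEnriched T).Algebra)
    {J : S →₀ ℕ} {s : S} (e : Sg.Eqn J s) : Prop :=
  e.1.interp A = e.2.interp A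

/-- Satisfaction of a relation `R t₁ … tₙ` among terms of sort `s` in context `v : J`: it has to
hold for the interpretations of the terms, as elements of the internal hom `[A^J, A_s]`. -/
def EnrichedSignature.Algebra.SatRel [MonoidalClosed T.Mod] {Sg : ClassicalSignature S}
    (A : (Sg.toEnriched T).Algebra) {J : S →₀ ℕ} {s : S} (e : L.Edge (Sg.Term J s)) : Prop :=
  e.map (fun t => homElem (t.interp A)) ∈ ((ihom (A.carrier.pow J)).obj (A.carrier s)).edges

/-- The objects of the full enriched subcategory on the objects with a given property. -/
structure FullSub {C : Type (u + 1)} (p : C → Prop) : Type (u + 1) where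
  /-- the underlying object -/
  obj : C
  property : p obj

namespace FullSub

variable (V : Type (u + 1)) [Category.{u} V] [MonoidalCategory V] {C : Type (u + 1)}
    [EnrichedCategory V C] (p : C → Prop)

instance : EnrichedCategory V (FullSub p) where
  Hom X Y := EnrichedCategory.Hom X.obj Y.obj
  id X := eId V X.obj
  comp X Y Z := eComp V X.obj Y.obj Z.obj
  id_comp X Y := e_id_comp V X.obj Y.obj
  comp_id X Y := e_comp_id V X.obj Y.obj
  assoc W X Y Z := e_assoc V W.obj X.obj Y.obj Z.obj

/-- The inclusion of a full enriched subcategory. -/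
def incl : EnrichedFunctor V (FullSub p) C where
  obj X := X.obj
  map X Y := 𝟙 (X.obj ⟶[V] Y.obj)
  map_id _ := Category.comp_id _
  map_comp X Y Z := by
    have h : eComp V X.obj Y.obj Z.obj ≫ 𝟙 (X.obj ⟶[V] Z.obj) =
        (𝟙 (X.obj ⟶[V] Y.obj) ⊗ₘ 𝟙 (Y.obj ⟶[V] Z.obj)) ≫ eComp V X.obj Y.obj Z.obj := by
      rw [id_tensorHom_id, Category.id_comp, Category.comp_id]
    exact h

end FullSub

/-- A `T-Mod`-enriched `S`-sorted equational theory: an enriched signature together with a set of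
syntactic equations over the underlying classical signature. -/
structure EnrichedTheory {L : RelSignature.{u}} {Var : Type u} (T : HornTheory L Var)
    (S : Type u) where
  /-- the signature -/
  sig : EnrichedSignature T S
  /-- the equations of each sort in each context -/
  eqns : ∀ (J : S →₀ ℕ) (s : S), Set (sig.underlying.Eqn J s)

namespace EnrichedTheory

variable [T.IsReflexive]

/-- An algebra for the signature is an algebra for the theory if its underlying algebra satisfies
the equations. -/
def IsAlg (E : EnrichedTheory T S) (A : E.sig.Algebra) : Prop :=
  ∀ (J : S →₀ ℕ) (s : S), ∀ e ∈ E.eqns J s, A.underlying.SatEqn e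

variable [MonoidalClosed T.Mod]

/-- The enriched category of algebras for an enriched theory. -/
abbrev Alg (E : EnrichedTheory T S) : Type (u + 1) := FullSub E.IsAlg

/-- The forgetful enriched functor to `T-Mod^S`. -/
def forget (E : EnrichedTheory T S) : EnrichedFunctor T.Mod E.Alg (Fam T S) :=
  (FullSub.incl T.Mod E.IsAlg).comp T.Mod E.sig.forget

end EnrichedTheory

/-- A classical `S`-sorted equational theory with `T`-relations: a classical signature, a set of
relations among terms of equal sort in a common context, and a set of syntactic equations. -/
structure RelationalTheory (L : RelSignature.{u}) (S : Type u) where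
  /-- the signature -/
  sig : ClassicalSignature S
  /-- the relations of each sort in each context -/
  rels : ∀ (J : S →₀ ℕ) (s : S), Set (L.Edge (sig.Term J s))
  /-- the equations of each sort in each context -/
  eqns : ∀ (J : S →₀ ℕ) (s : S), Set (sig.Eqn J s)

namespace RelationalTheory

/-- The algebras for the signature that satisfy all relations and all equations. -/
def IsAlg [MonoidalClosed T.Mod] (P : RelationalTheory L S) (A : (P.sig.toEnriched T).Algebra) : Prop :=
  (∀ (J : S →₀ ℕ) (s : S), ∀ e ∈ P.rels J s, A.SatRel e) ∧
    ∀ (J : S →₀ ℕ) (s : S), ∀ e ∈ P.eqns J s, A.SatEqn e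

/-- The enriched category of algebras for a classical theory with relations. -/
abbrev Alg (P : RelationalTheory L S) (T : HornTheory L Var) [MonoidalClosed T.Mod]
    [T.IsReflexive] : Type (u + 1) :=
  FullSub (P.IsAlg (T := T))

/-- The forgetful enriched functor to `T-Mod^S`. -/
def forget (P : RelationalTheory L S) (T : HornTheory L Var) [MonoidalClosed T.Mod]
    [T.IsReflexive] : EnrichedFunctor T.Mod (P.Alg T) (Fam T S) :=
  (FullSub.incl T.Mod (P.IsAlg (T := T))).comp T.Mod (P.sig.toEnriched T).forget

/-- The structure `P_{J,s}`: its elements are the terms of sort `s` in context `v : J` that occur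
in some relation of the theory, and its edges are the relations of sort `s` in this context. -/
def termStr (P : RelationalTheory L S) (J : S →₀ ℕ) (s : S) : RelStr L where
  carrier := {t : P.sig.Term J s // ∃ e ∈ P.rels J s, ∃ i, e.2 i = t}
  edges := {e | e.map Subtype.val ∈ P.rels J s}

end RelationalTheory

/-- A free model on a structure `X`: a model with a universal morphism from `X`. -/
structure FreeModel (T : HornTheory L Var) (X : RelStr L) where
  /-- the free model -/
  model : T.Mod
  /-- the unit -/
  unit : RelStr.Hom X model.toRelStr
  universal : ∀ (Y : T.Mod) (f : RelStr.Hom X Y.toRelStr),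
    ∃! g : RelStr.Hom model.toRelStr Y.toRelStr, unit.comp g = f

namespace RelationalTheory

variable (P : RelationalTheory L S) (F : ∀ (J : S →₀ ℕ) (s : S), FreeModel T (P.termStr J s))

/-- The signature of `P` with a new operation symbol of type `(J, s, F_{J,s})` adjoined for all
`J` and `s`, where `F_{J,s}` is the free model on the structure `P_{J,s}`. -/
def adjoinSig : EnrichedSignature T S where
  Op := P.sig.Op ⊕ ((S →₀ ℕ) × S)
  inputs := Sum.elim P.sig.inputs Prod.fst
  output := Sum.elim P.sig.output Prod.snd
  param := Sum.elim (fun _ => 𝟙_ T.Mod) (fun Js => (F Js.1 Js.2).model)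

/-- Terms over the signature of `P`, regarded as terms over the extended signature. -/
def liftTerm {J : S →₀ ℕ} :
    ∀ {s : S}, P.sig.Term J s → (P.adjoinSig F).underlying.Term J s
  | _, .var v => .var v
  | _, .app o args =>
      .app (Sg := (P.adjoinSig F).underlying) ⟨Sum.inl o, PUnit.unit⟩ fun v => liftTerm (args v)

/-- The term obtained by applying the new operation symbol of type `(J, s, F_{J,s})`, at the value
of the parameter that is the image of `t` under the unit, to the variables of the context. -/
def newTerm {J : S →₀ ℕ} {s : S} (t : P.termStr J s) : (P.adjoinSig F).underlying.Term J s :=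
  .app (Sg := (P.adjoinSig F).underlying) ⟨Sum.inr (J, s), (F J s).unit t⟩
    fun v : CtxVar J => .var v

/-- The enriched theory obtained from `P` by replacing its relations by the new operation symbols
and the equations that identify their values at (the images of) terms with these terms. -/
def adjoinFree : EnrichedTheory T S where
  sig := P.adjoinSig F
  eqns J s := {e | ∃ e' ∈ P.eqns J s, e = (P.liftTerm F e'.1, P.liftTerm F e'.2)} ∪
    {e | ∃ t : P.termStr J s, e = (P.newTerm F t, P.liftTerm F t.1)}

end RelationalTheory

end Theories

/-- Two enriched categories over `B` are isomorphic as such: there are mutually inverse enriched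
functors (up to equality) which commute with the functors to `B`. -/
def EnrichedIsoOver {V : Type (u + 1)} [Category.{u} V] [MonoidalCategory V]
    {B C D : Type (u + 1)} [EnrichedCategory V B] [EnrichedCategory V C] [EnrichedCategory V D]
    (U : EnrichedFunctor V C B) (W : EnrichedFunctor V D B) : Prop :=
  ∃ (G : EnrichedFunctor V C D) (H : EnrichedFunctor V D C),
    G.comp V H = EnrichedFunctor.id V C ∧ H.comp V G = EnrichedFunctor.id V D ∧
      G.comp V W = U ∧ H.comp V U = W

/-! Fix a sort `s` and a context `J`. An algebra `A` satisfies all relations of `P` of this sort and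
context exactly when `t ↦ t^A` is a morphism of structures from `P_{J,s}` to `[A^J, A_s]`. By
freeness such a morphism extends uniquely along the unit to the free model, and by closedness the
extension is a morphism from the free model times `A^J` to `A_s`. This is an interpretation of the
new symbol, and the added equations say precisely that it restricts to `t ↦ t^A` on generators.
Conversely, if these equations hold, then `t ↦ t^A` is the unit followed by the transpose of the new
operation, hence preserves edges. So algebras of the two theories correspond with unchanged carriers
(`restrict_isAlg`, `extend_isAlg`, `extend_restrict`).

On hom-objects nothing changes either (`isHom_restrict_iff`): a family that preserves the old
operations commutes with all terms, so it preserves the new operations at generators. For a fixed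
argument in `A^J`, both sides of the preservation law are morphisms in the parameter, so they agree
everywhere. Reflexivity enters here: it makes a map with one argument fixed a morphism. Both
hom-objects are then the same submodel of the hom-object of families. -/

namespace HornTheory

variable {L : RelSignature.{u}} {Var : Type u} {T : HornTheory L Var} {S : Type u}

/-! ## Free models -/

/-- Two elements of a structure are identified by all morphisms into models. -/
def freeSetoid (T : HornTheory L Var) (X : RelStr L) : Setoid X where
  r x y := ∀ (Y : T.Mod) (f : RelStr.Hom X Y.toRelStr), f x = f y
  iseqv := ⟨fun _ _ _ => rfl, fun h Y f => (h Y f).symm, fun h k Y f => (h Y f).trans (k Y f)⟩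

/-- The function on the quotient that is induced by a morphism into a model. -/
def freeDesc {X : RelStr L} {Y : T.Mod} (f : RelStr.Hom X Y.toRelStr) :
    Quotient (freeSetoid T X) → Y :=
  Quotient.lift f fun _ _ h => h Y f

/-- The free model on a structure is a quotient of it: no elements have to be added, since Horn
formulas assert edges and equations only. -/
def freeMod (T : HornTheory L Var) (X : RelStr L) : T.Mod where
  carrier := Quotient (freeSetoid T X)
  edges := {e | ∀ (Y : T.Mod) (f : RelStr.Hom X Y.toRelStr), e.map (freeDesc f) ∈ Y.edges}
  sat φ hφ κ hκ := by
    have h1 := fun (Y : T.Mod) (f : RelStr.Hom X Y.toRelStr) =>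
      Y.sat φ hφ (fun v => freeDesc f (κ v)) (fun e he => hκ e he Y f)
    rcases h : φ.conclusion with e | vw
    · simp only [h] at h1
      exact h1
    · simp only [h] at h1
      -- An equation in the quotient is tested by all morphisms into models, which is the definition
      -- of the setoid.
      have key : ∀ x y : Quotient (freeSetoid T X),
          (∀ (Y : T.Mod) (f : RelStr.Hom X Y.toRelStr), freeDesc f x = freeDesc f y) → x = y := by
        rintro ⟨x⟩ ⟨y⟩ hxy
        exact Quotient.sound hxy
      exact key _ _ h1

/-- Every structure has a free model. -/
def freeModel (T : HornTheory L Var) (X : RelStr L) : FreeModel T X where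
  model := freeMod T X
  unit := ⟨Quotient.mk _, fun e he _ f => f.map_edges e he⟩
  universal Y f := by
    -- Existence is built into the definition of the edges; uniqueness holds because the quotient
    -- map is surjective.
    refine ⟨⟨freeDesc f, fun e he => he Y f⟩, rfl, fun g hg => RelStr.Hom.ext (funext ?_)⟩
    rintro ⟨x⟩
    exact congrFun (congrArg RelStr.Hom.toFun hg) x

end HornTheory

namespace FreeModel

variable {L : RelSignature.{u}} {Var : Type u} {T : HornTheory L Var} {X : RelStr L}

/-- The extension of a morphism along the unit of a free model. -/
noncomputable def desc (F : FreeModel T X) {Y : T.Mod} (f : RelStr.Hom X Y.toRelStr) :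
    F.model ⟶ Y :=
  (F.universal Y f).choose

theorem desc_unit (F : FreeModel T X) {Y : T.Mod} (f : RelStr.Hom X Y.toRelStr) (x : X) :
    (F.desc f) (F.unit x) = f x :=
  congrFun (congrArg RelStr.Hom.toFun (F.universal Y f).choose_spec.1) x

/-- This is the uniqueness half of the universal property. It spreads equations known at generators
to all parameters, without appeal to surjectivity of the unit. -/
theorem hom_ext (F : FreeModel T X) {Y : T.Mod} {g h : F.model ⟶ Y}
    (H : ∀ x, g (F.unit x) = h (F.unit x)) : g = h :=
  (F.universal Y (F.unit.comp g)).unique rfl (RelStr.Hom.ext (funext fun x => (H x).symm))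

end FreeModel

/-! ## Sections of morphisms in several variables -/

namespace HornTheory

variable {L : RelSignature.{u}} {Var : Type u} {T : HornTheory L Var}

/-- The morphism `f(-, y)` obtained by fixing the second argument. -/
def fixRight [T.IsReflexive] {X Y Z : T.Mod} (f : X ⊗ Y ⟶ Z) (y : Y) : X ⟶ Z where
  toFun x := f ((x, y) : (X × Y : Type u))
  -- The given edge is paired with the constant tuple at `y`, which is an edge of `Y` by
  -- reflexivity.
  map_edges e he := f.map_edges (⟨e.1, fun i => ((e.2 i, y) : (X × Y : Type u))⟩ : L.Edge (X × Y))
    ⟨he, IsReflexive.refl Y e.1 y⟩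

variable [MonoidalClosed T.Mod]

/-- The transpose of a morphism with respect to its second argument. -/
def transpose {X Y Z : T.Mod} (f : X ⊗ Y ⟶ Z) : X ⟶ (ihom Y).obj Z :=
  -- `MonoidalClosed.curry` transposes the first factor, whereas the parameter is to remain the
  -- argument; hence the swap.
  MonoidalClosed.curry (lift (snd Y X) (fst Y X) ≫ f)

theorem evalAt_transpose {X Y Z : T.Mod} (f : X ⊗ Y ⟶ Z) (x : X) (y : Y) :
    evalAt ((transpose f) x) y = f ((x, y) : (X × Y : Type u)) :=
  evalAt_curry _ _ _

/-- The morphism in two arguments that corresponds to a morphism into an internal hom. -/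
def untranspose {X Y Z : T.Mod} (g : X ⟶ (ihom Y).obj Z) : X ⊗ Y ⟶ Z :=
  lift (snd X Y) (fst X Y ≫ g) ≫ (ihom.ev Y).app Z

theorem untranspose_apply {X Y Z : T.Mod} (g : X ⟶ (ihom Y).obj Z) (x : X) (y : Y) :
    (untranspose g) ((x, y) : (X × Y : Type u)) = evalAt (g x) y :=
  rfl

end HornTheory

/-! ## Terms and morphisms of algebras -/

section Terms

variable {L : RelSignature.{u}} {Var : Type u} {T : HornTheory L Var} {S : Type u}

/-- Morphisms of algebras commute with the interpretations of terms. -/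
theorem ClassicalSignature.Term.interp_powApply [MonoidalClosed T.Mod] [T.IsReflexive]
    {Sg : ClassicalSignature S} {A B : (Sg.toEnriched T).Algebra}
    {f : (A.carrier ⟶[T.Mod] B.carrier : T.Mod)} (hf : A.IsHom B f) {J : S →₀ ℕ} {s : S}
    (t : Sg.Term J s) (a : A.carrier.pow J) :
    (t.interp B) (EnrichedSignature.powApply f a) = evalAt (f s) ((t.interp A) a) := by
  induction t with
  | var v => rfl
  | app o args ih =>
    -- A classical operation has only one parameter, so the homomorphism law is used at that point
    -- and at the tuple of values of the subterms.
    have h := (A.isHom_iff B f).1 hf o PUnit.unit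
      (fun v : CtxVar (Sg.inputs o) => ((args v).interp A) a)
    refine Eq.trans ?_ h
    exact congrArg (fun b : B.carrier.pow (Sg.inputs o) => (B.op o)
      ((PUnit.unit, b) : (PUnit × B.carrier.pow (Sg.inputs o) : Type u))) (funext ih)

end Terms

/-! ## Algebras for the extended theory -/

namespace RelationalTheory

variable {L : RelSignature.{u}} {Var : Type u} {T : HornTheory L Var} {S : Type u}
variable (P : RelationalTheory L S) (F : ∀ (J : S →₀ ℕ) (s : S), FreeModel T (P.termStr J s))

/-- The restriction of an algebra for the extended signature to the original signature. -/
def restrict (B : (P.adjoinSig F).Algebra) : (P.sig.toEnriched T).Algebra where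
  carrier := B.carrier
  op o := B.op (Sum.inl o)

section Extend

variable [MonoidalClosed T.Mod]

/-- The terms that occur in the relations, interpreted in an algebra that satisfies them. -/
def termStrInterp {A : (P.sig.toEnriched T).Algebra} (hA : P.IsAlg A) (J : S →₀ ℕ) (s : S) :
    RelStr.Hom (P.termStr J s) ((ihom (A.carrier.pow J)).obj (A.carrier s)).toRelStr where
  toFun t := homElem (t.1.interp A)
  map_edges _ he := hA.1 J s _ he

/-- The extension of an algebra that satisfies the relations: the new operation symbols are
interpreted by means of the universal property of the free models. -/
noncomputable def extend {A : (P.sig.toEnriched T).Algebra} (hA : P.IsAlg A) :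
    (P.adjoinSig F).Algebra where
  carrier := A.carrier
  op
    | Sum.inl o => A.op o
    | Sum.inr Js => untranspose ((F Js.1 Js.2).desc (P.termStrInterp hA Js.1 Js.2))

/-- The extension along the unit sends the image of `t` to the element of `[A^J, A_s]` named by
`t^A`. This is what validates the added equations. -/
theorem extend_op_unit {A : (P.sig.toEnriched T).Algebra} (hA : P.IsAlg A) {J : S →₀ ℕ} {s : S}
    (t : P.termStr J s) (a : A.carrier.pow J) :
    ((P.extend F hA).op (Sum.inr (J, s))) (((F J s).unit t, a) :
      ((F J s).model × A.carrier.pow J : Type u)) = (t.1.interp A) a :=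
  (congrArg (fun h => evalAt h a) ((F J s).desc_unit (P.termStrInterp hA J s) t)).trans
    (evalAt_homElem _ _)

end Extend

/-! ### Comparison of algebras and of their morphisms -/

variable [T.IsReflexive]

/-- A lifted term contains no new symbol, so only the restriction of `B` enters its interpretation.
-/
theorem interp_liftTerm (B : (P.adjoinSig F).Algebra) {J : S →₀ ℕ} {s : S} (t : P.sig.Term J s) :
    (P.liftTerm F t).interp B.underlying = t.interp (P.restrict F B) := by
  apply Mod.hom_ext'
  intro a
  induction t with
  | var v => rfl
  | app o args ih =>
    exact congrArg (fun b : B.carrier.pow (P.sig.inputs o) => (B.op (Sum.inl o))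
      ((PUnit.unit, b) : (PUnit × B.carrier.pow (P.sig.inputs o) : Type u))) (funext ih)

theorem interp_newTerm_apply (B : (P.adjoinSig F).Algebra) {J : S →₀ ℕ} {s : S}
    (t : P.termStr J s) (a : B.carrier.pow J) :
    ((P.newTerm F t).interp B.underlying) a = (B.op (Sum.inr (J, s)))
      (((F J s).unit t, a) : ((F J s).model × B.carrier.pow J : Type u)) :=
  rfl

/-- An algebra is an algebra for the extended theory if and only if its restriction satisfies the
equations and the new operations take the required values at the generators. -/
theorem adjoinFree_isAlg_iff (B : (P.adjoinSig F).Algebra) :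
    (P.adjoinFree F).IsAlg B ↔
      (∀ (J : S →₀ ℕ) (s : S), ∀ e ∈ P.eqns J s, (P.restrict F B).SatEqn e) ∧
      ∀ (J : S →₀ ℕ) (s : S) (t : P.termStr J s) (a : B.carrier.pow J),
        (B.op (Sum.inr (J, s))) (((F J s).unit t, a) :
          ((F J s).model × B.carrier.pow J : Type u)) = (t.1.interp (P.restrict F B)) a := by
  constructor
  · intro h
    refine ⟨fun J s e he => ?_, fun J s t a => ?_⟩
    · have := h J s _ (Or.inl ⟨e, he, rfl⟩)
      exact (P.interp_liftTerm F B e.1).symm.trans (this.trans (P.interp_liftTerm F B e.2))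
    · have := (h J s _ (Or.inr ⟨t, rfl⟩)).trans (P.interp_liftTerm F B t.1)
      exact congrFun (congrArg RelStr.Hom.toFun this) a
  · rintro ⟨h1, h2⟩ J s _ (⟨e, he, rfl⟩ | ⟨t, rfl⟩)
    · exact (P.interp_liftTerm F B e.1).trans
        ((h1 J s e he).trans (P.interp_liftTerm F B e.2).symm)
    · exact (Mod.hom_ext' (h2 J s t)).trans (P.interp_liftTerm F B t.1).symm

variable [MonoidalClosed T.Mod]

/-- The relations hold because both the unit and the transpose of the new operation preserve edges,
and the added equations identify their composite with the interpretation of terms. -/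
theorem restrict_isAlg {B : (P.adjoinSig F).Algebra} (hB : (P.adjoinFree F).IsAlg B) :
    P.IsAlg (P.restrict F B) := by
  obtain ⟨h1, h2⟩ := (P.adjoinFree_isAlg_iff F B).1 hB
  refine ⟨fun J s e he => ?_, h1⟩
  -- The relation `e` as an edge of `P_{J,s}`; `e` itself witnesses that each of its terms occurs in
  -- a relation.
  let e' : L.Edge (P.termStr J s) := ⟨e.1, fun i => ⟨e.2 i, e, he, i, rfl⟩⟩
  let g : (F J s).model ⟶ (ihom (B.carrier.pow J)).obj (B.carrier s) :=
    transpose (B.op (Sum.inr (J, s)))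
  have h := g.map_edges _ ((F J s).unit.map_edges e' he)
  have key : (fun t : P.termStr J s => homElem (t.1.interp (P.restrict F B))) =
      fun t => g ((F J s).unit t) := by
    funext t
    apply evalAt_ext
    intro a
    exact (evalAt_homElem _ _).trans ((h2 J s t a).symm.trans (evalAt_transpose _ _ _).symm)
  -- Stated for `e'` so that `key` can rewrite the function; the images of `e` and `e'` agree by
  -- definition.
  have h' : e'.map (fun t : P.termStr J s => homElem (t.1.interp (P.restrict F B))) ∈
      ((ihom (B.carrier.pow J)).obj (B.carrier s)).edges := by
    rw [key]
    exact h
  exact h'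

theorem extend_isAlg {A : (P.sig.toEnriched T).Algebra} (hA : P.IsAlg A) :
    (P.adjoinFree F).IsAlg (P.extend F hA) :=
  (P.adjoinFree_isAlg_iff F _).2 ⟨hA.2, fun _ _ t a => P.extend_op_unit F hA t a⟩

/-- The added equations leave no freedom: they fix the new operations at generators, hence at every
parameter. -/
theorem extend_restrict {B : (P.adjoinSig F).Algebra} (hB : (P.adjoinFree F).IsAlg B) :
    P.extend F (P.restrict_isAlg F hB) = B := by
  have h2 := ((P.adjoinFree_isAlg_iff F B).1 hB).2
  have h : (P.extend F (P.restrict_isAlg F hB)).op = B.op := by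
    funext o
    rcases o with o | ⟨J, s⟩
    · rfl
    · apply Mod.hom_ext'
      rintro ⟨p, a⟩
      -- With `a` fixed, both operations become morphisms out of the free model, to be compared at
      -- generators only.
      have key : fixRight ((P.extend F (P.restrict_isAlg F hB)).op (Sum.inr (J, s))) a =
          fixRight (B.op (Sum.inr (J, s))) a :=
        (F J s).hom_ext fun t =>
          (P.extend_op_unit F (P.restrict_isAlg F hB) t a).trans (h2 J s t a).symm
      exact congrFun (congrArg RelStr.Hom.toFun key) p
  exact congrArg (EnrichedSignature.Algebra.mk B.carrier) h

/-- For algebras of the extended theory, the morphisms are those of the restricted algebras. -/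
theorem isHom_restrict_iff {A B : (P.adjoinSig F).Algebra} (hA : (P.adjoinFree F).IsAlg A)
    (hB : (P.adjoinFree F).IsAlg B) (f : (A.carrier ⟶[T.Mod] B.carrier : T.Mod)) :
    (P.restrict F A).IsHom (P.restrict F B) f ↔ A.IsHom B f := by
  constructor
  · intro hf
    have hA2 := ((P.adjoinFree_isAlg_iff F A).1 hA).2
    have hB2 := ((P.adjoinFree_isAlg_iff F B).1 hB).2
    rw [A.isHom_iff B]
    rintro (o | ⟨J, s⟩) p a
    · exact ((P.restrict F A).isHom_iff (P.restrict F B) f).1 hf o p a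
    -- For fixed `a`, both sides of the law are morphisms in the parameter. At a generator the added
    -- equations reduce it to the compatibility of `f` with the term `t`. Evaluation of `f s` is a
    -- morphism since the constant tuple at `f s` is an edge by reflexivity.
    · have key : fixRight (B.op (Sum.inr (J, s))) (EnrichedSignature.powApply f a) =
          fixRight (A.op (Sum.inr (J, s))) a ≫ ⟨fun x => evalAt (f s) x, fun e he =>
            ((ihom.ev (A.carrier s)).app (B.carrier s)).map_edges
              (⟨e.1, fun i => (e.2 i, f s)⟩ : L.Edge (A.carrier s × _))
              ⟨he, IsReflexive.refl _ e.1 (f s)⟩⟩ :=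
        (F J s).hom_ext fun t =>
          (hB2 J s t _).trans ((t.1.interp_powApply hf a).trans
            (congrArg (evalAt (f s)) (hA2 J s t a).symm))
      exact congrFun (congrArg RelStr.Hom.toFun key) p
  · exact fun hf => ((P.restrict F A).isHom_iff (P.restrict F B) f).2 fun o p a =>
      (A.isHom_iff B f).1 hf (Sum.inl o) p a

/-- Extension of algebras, as an enriched functor. -/
noncomputable def extendFunctor : EnrichedFunctor T.Mod (P.Alg T) (P.adjoinFree F).Alg where
  obj A := ⟨P.extend F A.property, P.extend_isAlg F A.property⟩
  map A B := (subLift (subIncl _ (A.obj.IsHom B.obj)) fun f =>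
    (P.isHom_restrict_iff F (P.extend_isAlg F A.property) (P.extend_isAlg F B.property) f.1).1 f.2)
  map_id _ := rfl
  map_comp _ _ _ := rfl

/-- Restriction of algebras, as an enriched functor. -/
def restrictFunctor : EnrichedFunctor T.Mod (P.adjoinFree F).Alg (P.Alg T) where
  obj B := ⟨P.restrict F B.obj, P.restrict_isAlg F B.property⟩
  map A B := (subLift (subIncl _ (A.obj.IsHom B.obj)) fun f =>
    (P.isHom_restrict_iff F A.property B.property f.1).2 f.2)
  map_id _ := rfl
  map_comp _ _ _ := rfl

end RelationalTheory

/-! ### The isomorphism over families of models -/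

/-- Enriched functors which agree on objects are equal if their composites with an enriched functor
that is monic on hom-objects are equal. -/
theorem enrichedFunctor_eq_of_comp_eq {V : Type (u + 1)} [Category.{u} V] [MonoidalCategory V]
    {B C D : Type (u + 1)} [EnrichedCategory V B] [EnrichedCategory V C] [EnrichedCategory V D]
    (W : EnrichedFunctor V D B) (hW : ∀ X Y, Mono (W.map X Y)) {G H : EnrichedFunctor V C D}
    (hobj : G.obj = H.obj) (h : G.comp V W = H.comp V W) : G = H := by
  obtain ⟨Go, Gm, _, _⟩ := G
  obtain ⟨Ho, Hm, _, _⟩ := H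
  -- Once the object maps are identified, the two families of hom-maps have the same type and can be
  -- compared.
  obtain rfl : Go = Ho := hobj
  have h' : (fun X Y => Gm X Y ≫ W.map (Go X) (Go Y)) =
      fun X Y => Hm X Y ≫ W.map (Go X) (Go Y) := by
    simpa [EnrichedFunctor.comp] using h
  obtain rfl : Gm = Hm := by
    funext X Y
    exact (cancel_mono (W.map (Go X) (Go Y))).1 (congrFun (congrFun h' X) Y)
  rfl

/-- The inclusion of a submodel is a monomorphism. -/
theorem HornTheory.mono_subIncl {L : RelSignature.{u}} {Var : Type u} {T : HornTheory L Var}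
    (X : T.Mod) (p : X → Prop) : Mono (subIncl X p) where
  right_cancellation _ _ h := Mod.hom_ext' fun z => Subtype.ext <|
    congrFun (congrArg RelStr.Hom.toFun h) z

/-- The algebras for a relational theory form an enriched category isomorphic to that of the
algebras for the extended theory. -/
theorem RelationalTheory.enrichedIsoOver_adjoinFree {L : RelSignature.{u}} {Var : Type u}
    {T : HornTheory L Var} [T.IsReflexive] [MonoidalClosed T.Mod] {S : Type u}
    (P : RelationalTheory L S) (F : ∀ (J : S →₀ ℕ) (s : S), FreeModel T (P.termStr J s)) :
    EnrichedIsoOver (P.forget T) (P.adjoinFree F).forget := by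
  refine ⟨P.extendFunctor F, P.restrictFunctor F, ?_, ?_, rfl, rfl⟩
  -- Restricting an extended algebra returns it by definition; in the other order the object
  -- equality needs `extend_restrict`.
  · exact enrichedFunctor_eq_of_comp_eq (P.forget T) (fun A B => mono_subIncl _ _) rfl rfl
  · refine enrichedFunctor_eq_of_comp_eq (P.adjoinFree F).forget (fun A B => mono_subIncl _ _)
      (funext fun B => ?_) rfl
    obtain ⟨B, hB⟩ := B
    have h := P.extend_restrict F hB
    change (⟨P.extend F (P.restrict_isAlg F hB), _⟩ : (P.adjoinFree F).Alg) = ⟨B, hB⟩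
    congr 1

/-- Every classical sorted equational theory with relations of a reflexive relational Horn theory
with cartesian closed category of models is equivalent to an enriched equational theory. -/
theorem mainTheorem7 {L : RelSignature.{u}} {Var : Type u} [Infinite Var]
    (T : HornTheory L Var) [T.IsReflexive] [MonoidalClosed T.Mod] {S : Type u}
    (P : RelationalTheory L S) :
    ∃ E : EnrichedTheory T S,
      (∃ F : ∀ (J : S →₀ ℕ) (s : S), FreeModel T (P.termStr J s), E = P.adjoinFree F) ∧
        EnrichedIsoOver (P.forget T) E.forget :=
  -- The isomorphism holds for any choice of free models; `freeModel` supplies one.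
  ⟨P.adjoinFree fun J s => freeModel T (P.termStr J s), ⟨_, rfl⟩, P.enrichedIsoOver_adjoinFree _⟩
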